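/- Let $A$ be a finite-dimensional complex Hilbert space of dimension $|A|$, let $n\in\mathbb{N}$, and let $\rho_n,\sigma_n$ be density operators on $A^{\otimes n}$ (positive semidefinite, of trace one) that are symmetric under permutations of the $n$ tensor factors, i.e. $U_\pi\rho_nU_\pi^\dagger=\rho_n$ and $U_\pi\sigma_nU_\pi^\dagger=\sigma_n$ for every permutation $\pi$ of $\{1,\dots,n\}$, where $U_\pi$ is the unitary that permutes the tensor factors according to $\pi$. Suppose that $\operatorname{supp}(\rho_n)\subseteq\operatorname{supp}(\sigma_n)$, where the support of an operator is the orthogonal complement of its kernel. Then for all $\mu,r\in\mathbb{R}$ and $s\in[0,1]$ the numbers $\operatorname{tr}[\rho_n^{1+s}]$ and $\operatorname{tr}[\rho_n\sigma_n^{-s}]$ are strictly positive and $$\operatorname{tr}\left(\rho_n-2^{\mu n}\sigma_n\right)_+\;\le\;2^{-nrs+\log\operatorname{tr}[\rho_n^{1+s}]}+2^{-ns(\mu-r)+s|A|\log(1+n)+\log\operatorname{tr}[\rho_n\sigma_n^{-s}]},$$ that is, $$\operatorname{tr}\left(\rho_n-2^{\mu n}\sigma_n\right)_+\;\le\;2^{-nrs}\operatorname{tr}[\rho_n^{1+s}]+2^{-ns(\mu-r)}(1+n)^{s|A|}\operatorname{tr}[\rho_n\sigma_n^{-s}].$$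 Here $\log$ is the logarithm to base $2$, $X_+$ is the positive part of a Hermitian operator $X$, and real powers of a positive semidefinite operator are taken on its support (and are zero on its kernel). -/

import Mathlib

namespace QSym

/-- Operators on `A^n`, written as matrices in the product basis. The type `A` labels an
orthonormal basis of the one-system Hilbert space, so the dimension `|A|` is `Fintype.card A`, and
`x : Fin n → A` labels the product vector `|x 0⟩ ⊗ ⋯ ⊗ |x (n-1)⟩`. -/
abbrev Op (A : Type*) (n : ℕ) := Matrix (Fin n → A) (Fin n → A) ℂ

open scoped ComplexOrder in
/-- Density matrices: positive semidefinite with trace one. -/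
def IsDensity {I : Type*} [Fintype I] (ρ : Matrix I I ℂ) : Prop :=
  ρ.PosSemidef ∧ ρ.trace = 1

/-- The unitary on `A^n` permuting the tensor factors: it sends the product basis vector `|y⟩` to
`|y ∘ π⁻¹⟩`, i.e. it moves the content of factor `i` to factor `π i`. -/
def permOp {A : Type*} [DecidableEq A] {n : ℕ} (π : Equiv.Perm (Fin n)) : Op A n :=
  Matrix.of fun x y => if x = y ∘ π.symm then 1 else 0

/-- Symmetry under permutations of the `n` subsystems: `U_π X U_π† = X` for every `π`. -/
def IsPermSymmetric {A : Type*} [Fintype A] [DecidableEq A] {n : ℕ} (X : Op A n) : Prop :=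
  ∀ π : Equiv.Perm (Fin n), permOp π * X * (permOp π).conjTranspose = X

/-- The support of an operator: the orthogonal complement of its kernel. -/
noncomputable def supp {I : Type*} [Fintype I] [DecidableEq I] (X : Matrix I I ℂ) :
    Submodule ℂ (EuclideanSpace ℂ I) :=
  (LinearMap.ker (Matrix.toEuclideanLin X))ᗮ

/-- The real power `X ^ p` of a positive semidefinite matrix, taken on its support: by functional
calculus, with every eigenvalue `x ≠ 0` replaced by `x ^ p` and the eigenvalue `0` kept. -/
noncomputable def mpow {I : Type*} [Fintype I] [DecidableEq I] (X : Matrix I I ℂ) (p : ℝ) :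
    Matrix I I ℂ :=
  cfc (fun x : ℝ => if x = 0 then 0 else x ^ p) X

/-- The trace as a real number (all traces below are of operators with real trace). -/
noncomputable def rtr {I : Type*} [Fintype I] (X : Matrix I I ℂ) : ℝ := X.trace.re

end QSym

open scoped ComplexOrder Matrix

/-! Let `T` be the projection cutting out the positive part of `ρ - cσ`. Since `T = Tᴴ = T²`, the
trace of that part is the quadratic form `2 Re tr(Tρ) - tr(TρTᴴ) - c tr(σTTᴴ)` in `T`. In eigenbases
of `σ` and `ρ` it splits into one scalar quadratic per pair of eigenvectors, so commutativity is not
needed. With `a` an eigenvalue of `ρ`, `b` one of `cσ`, and `w` the overlap, completing the square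
bounds each term by `a² |w|² / (a + b)` (`quadratic_le_suppPow`). Then `a / (a + b) ≤ (a / t)^s + (t
/ b)^s`, and summing gives both traces (`rtr_posPart_sub_smul_le`). The theorem takes `t = 2^(nr)`,
`c = 2^(μn)`. -/

namespace QSym

/-! ### Scalar inequalities -/

section Pointwise

/-- The scalar function behind `mpow`: the power `x ^ p`, with the value `0` at `x = 0`. -/
noncomputable def suppPow (p x : ℝ) : ℝ := if x = 0 then 0 else x ^ p

lemma suppPow_zero (p : ℝ) : suppPow p 0 = 0 := by simp [suppPow]

lemma suppPow_of_pos {x : ℝ} (hx : 0 < x) (p : ℝ) : suppPow p x = x ^ p := by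
  simp [suppPow, hx.ne']

lemma suppPow_nonneg {x : ℝ} (hx : 0 ≤ x) (p : ℝ) : 0 ≤ suppPow p x := by
  rcases hx.eq_or_lt with rfl | hx
  · simp [suppPow_zero]
  · rw [suppPow_of_pos hx]; positivity

lemma suppPow_mul {c x : ℝ} (hc : 0 < c) (hx : 0 ≤ x) (p : ℝ) :
    suppPow p (c * x) = c ^ p * suppPow p x := by
  rcases hx.eq_or_lt with rfl | hx
  · simp [suppPow_zero]
  · rw [suppPow_of_pos hx, suppPow_of_pos (mul_pos hc hx), Real.mul_rpow hc.le hx.le]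

/-- The left side is at most `1`, so a term with `t ≤ a` or `b ≤ t` suffices. Otherwise `a ≤ t ≤ b`,
and `a / (a + b) ≤ t / b ≤ (t / b)^s` because `s ≤ 1`. -/
lemma div_add_le_rpow_add_rpow {a b s t : ℝ} (ha : 0 < a) (hb : 0 < b) (ht : 0 < t)
    (hs : s ∈ Set.Icc (0 : ℝ) 1) :
    a / (a + b) ≤ (a / t) ^ s + (t / b) ^ s := by
  obtain ⟨hs0, hs1⟩ := hs
  have h1 : a / (a + b) ≤ 1 := (div_le_one (by positivity)).2 (by linarith)
  have hat : 0 < (a / t) ^ s := by positivity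
  have htb : 0 < (t / b) ^ s := by positivity
  rcases le_total t a with h | h
  · have := Real.one_le_rpow ((one_le_div ht).2 h) hs0
    linarith
  rcases le_total b t with h' | h'
  · have := Real.one_le_rpow ((one_le_div hb).2 h') hs0
    linarith
  have h2 : a / (a + b) ≤ t / b := by
    rw [div_le_div_iff₀ (by positivity) hb]
    nlinarith [mul_pos ht ha]
  have h3 : t / b ≤ (t / b) ^ s := by
    simpa using Real.rpow_le_rpow_of_exponent_ge (by positivity) ((div_le_one hb).2 h') hs1
  linarith

/-- The maximum over `z` is attained at `z = a w / (a + b)`. The hypothesis `hw` is the scalar trace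
of support inclusion: at `b = 0` the second term on the right vanishes and could not compensate. -/
lemma quadratic_le_suppPow {z w : ℂ} {a b s t : ℝ} (ha : 0 ≤ a) (hb : 0 ≤ b) (ht : 0 < t)
    (hs : s ∈ Set.Icc (0 : ℝ) 1) (hw : b = 0 → a ≠ 0 → w = 0) :
    2 * ((z * star w).re * a) - Complex.normSq z * a - Complex.normSq z * b ≤
      t ^ (-s) * (suppPow (1 + s) a * Complex.normSq w) +
        t ^ s * (suppPow (-s) b * a * Complex.normSq w) := by
  have hz := Complex.normSq_nonneg z
  have hw0 := Complex.normSq_nonneg w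
  have hfa := suppPow_nonneg ha (1 + s)
  have hfb := suppPow_nonneg hb (-s)
  have hR : 0 ≤ t ^ (-s) * (suppPow (1 + s) a * Complex.normSq w) +
        t ^ s * (suppPow (-s) b * a * Complex.normSq w) := by positivity
  rcases ha.eq_or_lt with rfl | ha'
  · nlinarith [mul_nonneg hz hb]
  rcases hb.eq_or_lt with rfl | hb'
  · obtain rfl := hw rfl ha'.ne'
    simp only [star_zero, mul_zero, Complex.zero_re, zero_mul, map_zero] at *
    nlinarith [mul_nonneg hz ha]
  have key := div_add_le_rpow_add_rpow ha' hb' ht hs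
  have hab : 0 < a + b := by positivity
  have hrhs : t ^ (-s) * (suppPow (1 + s) a * Complex.normSq w) +
        t ^ s * (suppPow (-s) b * a * Complex.normSq w) =
      ((a / t) ^ s + (t / b) ^ s) * (a * Complex.normSq w) := by
    rw [suppPow_of_pos ha', suppPow_of_pos hb', Real.rpow_add ha', Real.rpow_one,
      Real.div_rpow ha ht.le, Real.div_rpow ht.le hb, Real.rpow_neg ht.le, Real.rpow_neg hb]
    ring
  rw [hrhs]
  refine le_trans ?_ (mul_le_mul_of_nonneg_right key (by positivity))
  rw [div_mul_eq_mul_div, le_div_iff₀ hab]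
  simp only [Complex.normSq_apply, Complex.mul_re, Complex.star_def, Complex.conj_re,
    Complex.conj_im]
  -- With denominators cleared, the claim is `0 ≤ |(a + b) z - a w|²`.
  nlinarith [sq_nonneg ((a + b) * z.re - a * w.re), sq_nonneg ((a + b) * z.im - a * w.im)]

end Pointwise

/-! ### Traces as double sums over two eigenbases -/

section Trace

variable {I : Type*} [Fintype I] [DecidableEq I] {ρ σ : Matrix I I ℂ}

/-- The matrix of `Y` from an eigenbasis of `ρ` to an eigenbasis of `σ`. -/
noncomputable def eigenMatrix (hσ : σ.IsHermitian) (hρ : ρ.IsHermitian) (Y : Matrix I I ℂ) :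
    Matrix I I ℂ :=
  (hσ.eigenvectorUnitary : Matrix I I ℂ)ᴴ * Y * (hρ.eigenvectorUnitary : Matrix I I ℂ)

lemma cfc_eq_mul_diagonal_mul (hρ : ρ.IsHermitian) (f : ℝ → ℝ) :
    cfc f ρ = (hρ.eigenvectorUnitary : Matrix I I ℂ) *
      Matrix.diagonal (fun i => (f (hρ.eigenvalues i) : ℂ)) *
      (hρ.eigenvectorUnitary : Matrix I I ℂ)ᴴ := by
  rw [hρ.cfc_eq, Matrix.IsHermitian.cfc, Unitary.conjStarAlgAut_apply]
  rfl

lemma continuousOn_spectrum (X : Matrix I I ℂ) (f : ℝ → ℝ) : ContinuousOn f (spectrum ℝ X) :=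
  X.finite_real_spectrum.continuousOn f

lemma trace_cfc_mul_mul_cfc_mul (hσ : σ.IsHermitian) (hρ : ρ.IsHermitian) (f g : ℝ → ℝ)
    (Y Z : Matrix I I ℂ) :
    (cfc g σ * Y * cfc f ρ * Zᴴ).trace =
      ∑ i, ∑ j, (g (hσ.eigenvalues i) : ℂ) * (f (hρ.eigenvalues j) : ℂ) *
        (eigenMatrix hσ hρ Y i j * star (eigenMatrix hσ hρ Z i j)) := by
  have h : (cfc g σ * Y * cfc f ρ * Zᴴ).trace =
      (Matrix.diagonal (fun i => (g (hσ.eigenvalues i) : ℂ)) * eigenMatrix hσ hρ Y *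
        Matrix.diagonal (fun i => (f (hρ.eigenvalues i) : ℂ)) *
        (eigenMatrix hσ hρ Z)ᴴ).trace := by
    rw [cfc_eq_mul_diagonal_mul hσ, cfc_eq_mul_diagonal_mul hρ]
    simp only [Matrix.mul_assoc]
    rw [Matrix.trace_mul_comm]
    simp only [eigenMatrix, Matrix.conjTranspose_mul, Matrix.conjTranspose_conjTranspose,
      Matrix.mul_assoc]
  rw [h, Matrix.trace]
  refine Finset.sum_congr rfl fun i _ => ?_
  rw [Matrix.diag_apply, Matrix.mul_apply]
  refine Finset.sum_congr rfl fun j _ => ?_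
  rw [Matrix.mul_diagonal, Matrix.diagonal_mul, Matrix.conjTranspose_apply]
  ring

lemma rtr_cfc_mul_mul_cfc_mul (hσ : σ.IsHermitian) (hρ : ρ.IsHermitian) (f g : ℝ → ℝ)
    (Y Z : Matrix I I ℂ) :
    rtr (cfc g σ * Y * cfc f ρ * Zᴴ) =
      ∑ i, ∑ j, g (hσ.eigenvalues i) * f (hρ.eigenvalues j) *
        (eigenMatrix hσ hρ Y i j * star (eigenMatrix hσ hρ Z i j)).re := by
  rw [rtr, trace_cfc_mul_mul_cfc_mul hσ hρ]
  simp only [Complex.re_sum, ← Complex.ofReal_mul, Complex.re_ofReal_mul]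

lemma re_mul_star_self (z : ℂ) : (z * star z).re = Complex.normSq z := by
  simp [Complex.normSq_apply]

lemma rtr_mul_comm {J : Type*} [Fintype J] (X Y : Matrix J J ℂ) : rtr (X * Y) = rtr (Y * X) := by
  rw [rtr, rtr, Matrix.trace_mul_comm]

/-- The sum over `i` is redundant, but it puts this trace in the same double-sum form as the others,
for termwise comparison. -/
lemma rtr_mpow (hσ : σ.IsHermitian) (hρ : ρ.IsHermitian) (p : ℝ) :
    rtr (mpow ρ p) = ∑ i, ∑ j, suppPow p (hρ.eigenvalues j) *
      Complex.normSq (eigenMatrix hσ hρ 1 i j) := by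
  have h := rtr_cfc_mul_mul_cfc_mul hσ hρ (suppPow p) (fun _ => 1) 1 1
  simp only [re_mul_star_self, one_mul] at h
  rw [← h, cfc_const_one ℝ σ hσ.isSelfAdjoint]
  simp only [Matrix.conjTranspose_one, mul_one, one_mul]
  rfl

lemma rtr_mul_mpow (hσ : σ.IsHermitian) (hρ : ρ.IsHermitian) (p : ℝ) :
    rtr (ρ * mpow σ p) = ∑ i, ∑ j, suppPow p (hσ.eigenvalues i) * hρ.eigenvalues j *
      Complex.normSq (eigenMatrix hσ hρ 1 i j) := by
  have h := rtr_cfc_mul_mul_cfc_mul hσ hρ (fun x => x) (suppPow p) 1 1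
  simp only [re_mul_star_self] at h
  rw [← h, cfc_id' ℝ ρ hρ.isSelfAdjoint, rtr_mul_comm]
  simp only [Matrix.conjTranspose_one, mul_one]
  rfl

lemma rtr_mul_left (hσ : σ.IsHermitian) (hρ : ρ.IsHermitian) (Y Z : Matrix I I ℂ) :
    rtr (Y * ρ * Zᴴ) = ∑ i, ∑ j, hρ.eigenvalues j *
      (eigenMatrix hσ hρ Y i j * star (eigenMatrix hσ hρ Z i j)).re := by
  have h := rtr_cfc_mul_mul_cfc_mul hσ hρ (fun x => x) (fun _ => 1) Y Z
  simp only [one_mul] at h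
  rw [← h, cfc_id' ℝ ρ hρ.isSelfAdjoint, cfc_const_one ℝ σ hσ.isSelfAdjoint, one_mul]

lemma rtr_mul_right (hσ : σ.IsHermitian) (hρ : ρ.IsHermitian) (Y Z : Matrix I I ℂ) :
    rtr (σ * Y * Zᴴ) = ∑ i, ∑ j, hσ.eigenvalues i *
      (eigenMatrix hσ hρ Y i j * star (eigenMatrix hσ hρ Z i j)).re := by
  have h := rtr_cfc_mul_mul_cfc_mul hσ hρ (fun _ => 1) (fun x => x) Y Z
  simp only [mul_one] at h
  rw [← h, cfc_id' ℝ σ hσ.isSelfAdjoint, cfc_const_one ℝ ρ hρ.isSelfAdjoint, mul_one]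

/-- The positive part of a Hermitian matrix is cut out by an orthogonal projection. -/
lemma exists_projection_mul_eq_posPart {D : Matrix I I ℂ} (hD : D.IsHermitian) :
    ∃ T : Matrix I I ℂ, Tᴴ = T ∧ T * T = T ∧ T * D = D⁺ := by
  have hc := continuousOn_spectrum D
  refine ⟨cfc (fun x : ℝ => if 0 < x then (1 : ℝ) else 0) D, ?_, ?_, ?_⟩
  · exact cfc_predicate (p := IsSelfAdjoint) _ D
  · rw [← cfc_mul _ _ D (hc _) (hc _)]
    congr 1
    ext x
    split_ifs <;> simp
  · rw [CFC.posPart_def, cfcₙ_eq_cfc (hf := continuous_posPart.continuousOn) (hf0 := by simp)]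
    nth_rewrite 2 [← cfc_id' ℝ D hD.isSelfAdjoint]
    rw [← cfc_mul _ _ D (hc _) (hc _)]
    congr 1
    ext x
    split_ifs with h
    · simp [posPart_eq_self.2 h.le]
    · simp [posPart_eq_zero.2 (not_lt.1 h)]

/-- If `supp ρ ≤ supp σ`, an eigenvector of `σ` in its kernel is orthogonal to every eigenvector of
`ρ` outside the kernel of `ρ`. -/
lemma eigenMatrix_one_eq_zero_of_supp_le (hσ : σ.IsHermitian) (hρ : ρ.IsHermitian)
    (hsupp : supp ρ ≤ supp σ) {i j : I} (hi : hσ.eigenvalues i = 0)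
    (hj : hρ.eigenvalues j ≠ 0) : eigenMatrix hσ hρ 1 i j = 0 := by
  have hker : LinearMap.ker (Matrix.toEuclideanLin σ) ≤ LinearMap.ker (Matrix.toEuclideanLin ρ) :=
    Submodule.orthogonal_le_orthogonal_iff.1 hsupp
  have hmem : hσ.eigenvectorBasis i ∈ LinearMap.ker (Matrix.toEuclideanLin σ) := by
    rw [LinearMap.mem_ker, Matrix.toLpLin_apply, hσ.mulVec_eigenvectorBasis, hi]
    simp
  have hρi : Matrix.toEuclideanLin ρ (hσ.eigenvectorBasis i) = 0 := hker hmem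
  have hsymm := Matrix.isSymmetric_toEuclideanLin_iff.2 hρ
    (hσ.eigenvectorBasis i) (hρ.eigenvectorBasis j)
  rw [hρi, inner_zero_left, Matrix.toLpLin_apply, hρ.mulVec_eigenvectorBasis] at hsymm
  have hin : inner ℂ (hσ.eigenvectorBasis i) (hρ.eigenvectorBasis j) = 0 := by
    have : (0 : ℂ) = (hρ.eigenvalues j : ℂ) *
        inner ℂ (hσ.eigenvectorBasis i) (hρ.eigenvectorBasis j) := by
      rw [hsymm, ← inner_smul_right]
      rfl
    simpa [hj] using this.symm
  rw [← hin, eigenMatrix, Matrix.mul_one, Matrix.mul_apply, PiLp.inner_apply]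
  refine Finset.sum_congr rfl fun k _ => ?_
  simp [Matrix.conjTranspose_apply, mul_comm]

/-- The bound behind the main theorem, for arbitrary positive semidefinite matrices. -/
theorem rtr_posPart_sub_smul_le (hρ : ρ.PosSemidef) (hσ : σ.PosSemidef)
    (hsupp : supp ρ ≤ supp σ) {c s t : ℝ} (hc : 0 < c) (ht : 0 < t)
    (hs : s ∈ Set.Icc (0 : ℝ) 1) :
    rtr ((ρ - c • σ)⁺) ≤
      t ^ (-s) * rtr (mpow ρ (1 + s)) + (t / c) ^ s * rtr (ρ * mpow σ (-s)) := by
  have hD : (ρ - c • σ).IsHermitian :=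
    (hρ.isHermitian.isSelfAdjoint.sub (.smul (.all c) hσ.isHermitian.isSelfAdjoint))
  obtain ⟨T, hT, hTT, hTD⟩ := exists_projection_mul_eq_posPart hD
  have hρ' := hρ.isHermitian
  have hσ' := hσ.isHermitian
  have e1 : rtr (T * ρ * 1ᴴ) = rtr (T * ρ) := by simp
  have e2 : rtr (T * ρ * Tᴴ) = rtr (T * ρ) := by
    rw [hT, rtr_mul_comm, ← Matrix.mul_assoc, hTT]
  have e3 : rtr (σ * T * Tᴴ) = rtr (T * σ) := by
    rw [hT, Matrix.mul_assoc, hTT, rtr_mul_comm]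
  -- Of the two copies of `tr(Tρ)`, one stays linear in `T` and the other becomes quadratic through
  -- `T² = T`.
  have e4 : rtr ((ρ - c • σ)⁺) =
      2 * rtr (T * ρ * 1ᴴ) - rtr (T * ρ * Tᴴ) - c * rtr (σ * T * Tᴴ) := by
    rw [e1, e2, e3, ← hTD, Matrix.mul_sub, Matrix.mul_smul]
    simp only [rtr, Matrix.trace_sub, Matrix.trace_smul, Complex.sub_re, Complex.smul_re,
      smul_eq_mul]
    ring
  rw [e4, rtr_mul_left hσ' hρ', rtr_mul_left hσ' hρ', rtr_mul_right hσ' hρ',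
    rtr_mpow hσ' hρ', rtr_mul_mpow hσ' hρ']
  simp only [Finset.mul_sum, ← Finset.sum_sub_distrib, ← Finset.sum_add_distrib]
  refine Finset.sum_le_sum fun i _ => Finset.sum_le_sum fun j _ => ?_
  have hb := hσ.eigenvalues_nonneg i
  have h := quadratic_le_suppPow (z := eigenMatrix hσ' hρ' T i j)
    (w := eigenMatrix hσ' hρ' 1 i j) (hρ.eigenvalues_nonneg j) (mul_nonneg hc.le hb) ht hs
    fun h0 => eigenMatrix_one_eq_zero_of_supp_le hσ' hρ' hsupp
      ((mul_eq_zero.1 h0).resolve_left hc.ne')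
  rw [suppPow_mul hc hb, Real.rpow_neg hc.le] at h
  rw [Real.div_rpow ht.le hc.le, re_mul_star_self, div_eq_mul_inv]
  linarith

/-- If this sum of nonnegative terms vanished, each term would, and with them all terms of `tr ρ =
1`. -/
lemma rtr_mpow_pos (hρ : IsDensity ρ) (p : ℝ) : 0 < rtr (mpow ρ p) := by
  obtain ⟨hρ, htr⟩ := hρ
  have hρ' := hρ.isHermitian
  have h1 := rtr_mul_left hρ' hρ' 1 1
  have hnn : ∀ i j, 0 ≤ suppPow p (hρ'.eigenvalues j) *
      Complex.normSq (eigenMatrix hρ' hρ' 1 i j) := fun i j =>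
    mul_nonneg (suppPow_nonneg (hρ.eigenvalues_nonneg j) _) (Complex.normSq_nonneg _)
  simp only [re_mul_star_self, Matrix.conjTranspose_one, one_mul, mul_one] at h1
  rw [rtr_mpow hρ' hρ']
  refine lt_of_le_of_ne (Finset.sum_nonneg fun i _ => Finset.sum_nonneg fun j _ => hnn i j)
    fun h0 => ?_
  have hz : rtr ρ = 0 := by
    rw [h1]
    refine Finset.sum_eq_zero fun i _ => Finset.sum_eq_zero fun j _ => ?_
    have h2 := (Finset.sum_eq_zero_iff_of_nonneg fun i _ =>
      Finset.sum_nonneg fun j _ => hnn i j).1 h0.symm i (Finset.mem_univ i)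
    have h3 := (Finset.sum_eq_zero_iff_of_nonneg fun j _ => hnn i j).1 h2 j (Finset.mem_univ j)
    rcases (hρ.eigenvalues_nonneg j).eq_or_lt with h4 | h4
    · rw [← h4, zero_mul]
    · rw [suppPow_of_pos h4] at h3
      rw [(mul_eq_zero.1 h3).resolve_left (Real.rpow_pos_of_pos h4 _).ne', mul_zero]
  simp [rtr, htr] at hz

lemma rtr_mul_mpow_pos (hρ : IsDensity ρ) (hσ : σ.PosSemidef) (hsupp : supp ρ ≤ supp σ) (p : ℝ) :
    0 < rtr (ρ * mpow σ p) := by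
  obtain ⟨hρ, htr⟩ := hρ
  have hρ' := hρ.isHermitian
  have hσ' := hσ.isHermitian
  have h1 := rtr_mul_left hσ' hρ' 1 1
  have hnn : ∀ i j, 0 ≤ suppPow p (hσ'.eigenvalues i) * hρ'.eigenvalues j *
      Complex.normSq (eigenMatrix hσ' hρ' 1 i j) := fun i j =>
    mul_nonneg (mul_nonneg (suppPow_nonneg (hσ.eigenvalues_nonneg i) _)
      (hρ.eigenvalues_nonneg j)) (Complex.normSq_nonneg _)
  simp only [re_mul_star_self, Matrix.conjTranspose_one, one_mul, mul_one] at h1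
  rw [rtr_mul_mpow hσ' hρ']
  refine lt_of_le_of_ne (Finset.sum_nonneg fun i _ => Finset.sum_nonneg fun j _ => hnn i j)
    fun h0 => ?_
  have hz : rtr ρ = 0 := by
    rw [h1]
    refine Finset.sum_eq_zero fun i _ => Finset.sum_eq_zero fun j _ => ?_
    have h2 := (Finset.sum_eq_zero_iff_of_nonneg fun i _ =>
      Finset.sum_nonneg fun j _ => hnn i j).1 h0.symm i (Finset.mem_univ i)
    have h3 := (Finset.sum_eq_zero_iff_of_nonneg fun j _ => hnn i j).1 h2 j (Finset.mem_univ j)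
    rcases (hσ.eigenvalues_nonneg i).eq_or_lt with h4 | h4
    -- On the kernel of `σ` the power gives no information; support inclusion kills the overlap
    -- instead.
    · by_cases h5 : hρ'.eigenvalues j = 0
      · rw [h5, zero_mul]
      · rw [eigenMatrix_one_eq_zero_of_supp_le hσ' hρ' hsupp h4.symm h5, map_zero, mul_zero]
    · rw [suppPow_of_pos h4, mul_assoc] at h3
      exact (mul_eq_zero.1 h3).resolve_left (Real.rpow_pos_of_pos h4 _).ne'
  simp [rtr, htr] at hz

end Trace

end QSym

theorem mainTheorem11 {A : Type*} [Fintype A] [DecidableEq A] (n : ℕ) (μ : ℝ)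
    (ρ σ : QSym.Op A n) (hρ : QSym.IsDensity ρ) (hσ : QSym.IsDensity σ)
    (hρsymm : QSym.IsPermSymmetric ρ) (hσsymm : QSym.IsPermSymmetric σ)
    (hsupp : QSym.supp ρ ≤ QSym.supp σ)
    (r s : ℝ) (hs : s ∈ Set.Icc (0 : ℝ) 1) :
    0 < QSym.rtr (QSym.mpow ρ (1 + s)) ∧
    0 < QSym.rtr (ρ * QSym.mpow σ (-s)) ∧
    QSym.rtr ((ρ - ((2 : ℝ) ^ (μ * n)) • σ)⁺) ≤
      (2 : ℝ) ^ (-(n * r * s) + Real.logb 2 (QSym.rtr (QSym.mpow ρ (1 + s)))) +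
      (2 : ℝ) ^ (-(n * s * (μ - r)) + s * Fintype.card A * Real.logb 2 (1 + n)
        + Real.logb 2 (QSym.rtr (ρ * QSym.mpow σ (-s)))) := by
  have hu := QSym.rtr_mpow_pos hρ (1 + s)
  have hv := QSym.rtr_mul_mpow_pos hρ hσ.1 hsupp (-s)
  refine ⟨hu, hv, ?_⟩
  have h2 : (0 : ℝ) < 2 := two_pos
  have hmain := QSym.rtr_posPart_sub_smul_le hρ.1 hσ.1 hsupp
    (Real.rpow_pos_of_pos h2 (μ * n)) (Real.rpow_pos_of_pos h2 (n * r)) hs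
  have e1 : (2 : ℝ) ^ (-(n * r * s) + Real.logb 2 (QSym.rtr (QSym.mpow ρ (1 + s)))) =
      ((2 : ℝ) ^ (n * r)) ^ (-s) * QSym.rtr (QSym.mpow ρ (1 + s)) := by
    rw [Real.rpow_add h2, Real.rpow_logb h2 (by norm_num) hu, ← Real.rpow_mul h2.le]
    ring_nf
  have e2 : ((2 : ℝ) ^ (n * r) / (2 : ℝ) ^ (μ * n)) ^ s * QSym.rtr (ρ * QSym.mpow σ (-s)) ≤
      (2 : ℝ) ^ (-(n * s * (μ - r)) + s * Fintype.card A * Real.logb 2 (1 + n)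
        + Real.logb 2 (QSym.rtr (ρ * QSym.mpow σ (-s)))) := by
    rw [Real.rpow_add h2 _ (Real.logb _ _), Real.rpow_logb h2 (by norm_num) hv,
      ← Real.rpow_sub h2, ← Real.rpow_mul h2.le]
    refine mul_le_mul_of_nonneg_right ?_ hv.le
    refine Real.rpow_le_rpow_of_exponent_le one_le_two ?_
    -- The factor `(1 + n)^(s|A|)` is at least `1`, so inserting it only weakens the bound.
    have hlog : 0 ≤ Real.logb 2 (1 + n) := Real.logb_nonneg one_lt_two (by simp)
    have := mul_nonneg (mul_nonneg hs.1 (Nat.cast_nonneg (α := ℝ) (Fintype.card A))) hlog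
    linarith
  rw [e1]
  linarith
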